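/- For a topological space $Y$ let $\operatorname{ind}(Y)$, $\operatorname{Ind}(Y)$ and $\dim(Y)$ denote its small inductive dimension, its large inductive dimension and its covering dimension (defined by finite open covers and finite open refinements), each equal to $-1$ exactly when $Y=\emptyset$ and possibly $\infty$. Let $\widehat{\operatorname{ind}}(Y)$, $\widehat{\operatorname{Ind}}(Y)$ and $\widehat{\dim}(Y)$ denote the suprema of $\operatorname{ind}(Y')$, $\operatorname{Ind}(Y')$ and $\dim(Y')$, respectively, over all locally compact subsets $Y'\subseteq Y$. A closed subset $L$ of $X$ separates two points $x,y\in X$ if $X\setminus L$ is the union of two disjoint open sets, one containing $x$ and the other containing $y$. Let $D\ge 0$ be an integer and let $X$ be a metric space in which every pair of distinct points can be separated by a closed subset $L\subseteq X$ with $\widehat{\operatorname{ind}}(L)\le D-1$. Then $$\widehat{\operatorname{ind}}(X)=\widehat{\operatorname{Ind}}(X)=\widehat{\dim}(X)\le D .$$ In particular, every locally compact subset of $X$ has small inductive, large inductive and covering dimension at most $D$. -/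

import Mathlib

universe u

/-- `HasLargeInductiveDimensionLT n X`: the large inductive dimension of `X` is less than `n`.
Dimension `< 0` means empty; dimension `< n + 1` means that between any closed set `A` and any
open set `V ⊇ A` there is an open set whose frontier has dimension `< n`. -/
def HasLargeInductiveDimensionLT : ℕ → ∀ (X : Type u) [TopologicalSpace X], Prop
  | 0, X, _ => IsEmpty X
  | n + 1, X, _ => ∀ A V : Set X, IsClosed A → IsOpen V → A ⊆ V →
      ∃ U : Set X, IsOpen U ∧ A ⊆ U ∧ U ⊆ V ∧ HasLargeInductiveDimensionLT n (frontier U)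

/-- The large inductive dimension `Ind X`, where `⊥` stands for `-1` (the empty space) and `⊤`
for infinite dimension, as in Mathlib's `smallInductiveDimension`. -/
noncomputable def largeInductiveDimension (X : Type u) [TopologicalSpace X] : WithBot ℕ∞ :=
  sInf {n | ∀ i : ℕ, n < i → HasLargeInductiveDimensionLT i X}

/-- `HasCoveringDimensionLT n X`: the covering dimension of `X` is less than `n`, i.e. every finite
open cover has a finite open refinement such that every point lies in at most `n` members. -/
def HasCoveringDimensionLT (n : ℕ) (X : Type u) [TopologicalSpace X] : Prop :=
  ∀ 𝒰 : Set (Set X), 𝒰.Finite → (∀ U ∈ 𝒰, IsOpen U) → ⋃₀ 𝒰 = Set.univ →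
    ∃ 𝒱 : Set (Set X), 𝒱.Finite ∧ (∀ V ∈ 𝒱, IsOpen V) ∧ ⋃₀ 𝒱 = Set.univ ∧
      (∀ V ∈ 𝒱, ∃ U ∈ 𝒰, V ⊆ U) ∧ ∀ x : X, {V ∈ 𝒱 | x ∈ V}.encard ≤ n

/-- The covering dimension `dim X`, where `⊥` stands for `-1` (the empty space) and `⊤` for
infinite dimension. -/
noncomputable def coveringDimension (X : Type u) [TopologicalSpace X] : WithBot ℕ∞ :=
  sInf {n | ∀ i : ℕ, n < i → HasCoveringDimensionLT i X}

/-- Supremum of the small inductive dimensions of the locally compact subsets of `X`. -/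
noncomputable def indHat (X : Type u) [TopologicalSpace X] : WithBot ℕ∞ :=
  ⨆ (S : Set X) (_ : LocallyCompactSpace S), smallInductiveDimension S

/-- Supremum of the large inductive dimensions of the locally compact subsets of `X`. -/
noncomputable def largeIndHat (X : Type u) [TopologicalSpace X] : WithBot ℕ∞ :=
  ⨆ (S : Set X) (_ : LocallyCompactSpace S), largeInductiveDimension S

/-- Supremum of the covering dimensions of the locally compact subsets of `X`. -/
noncomputable def dimHat (X : Type u) [TopologicalSpace X] : WithBot ℕ∞ :=
  ⨆ (S : Set X) (_ : LocallyCompactSpace S), coveringDimension S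

/-- The closed set `L` separates `x` from `y` in `X`: the complement of `L` is the union of two
disjoint open sets, one containing `x` and the other `y`. -/
def IsClosedSeparator {X : Type u} [TopologicalSpace X] (L : Set X) (x y : X) : Prop :=
  IsClosed L ∧ ∃ U V : Set X, IsOpen U ∧ IsOpen V ∧ Disjoint U V ∧ U ∪ V = Lᶜ ∧ x ∈ U ∧ y ∈ V

/-! For a compact metric space `K`, each of `ind K < n`, `Ind K < n` and `dim K < n` is equivalent
to a partition of `K` into `n` strongly zero-dimensional subsets, called a coloring. A coloring
bounds `Ind`, hence `ind`, because frontiers can be chosen to avoid one color, and it bounds `dim`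
because each color admits a disjoint open refinement. Conversely, `ind` yields a coloring by
splitting off the frontiers of a countable base, and `dim` yields one by a Baire category argument
on sequences of real functions. A locally compact metric space is a disjoint union of clopen
σ-compact pieces, so colorings of its compact subsets glue by the countable sum theorem. Hence each
hat dimension is `< n` exactly when every compact subset has an `n`-coloring, and the three agree.
For the bound, take a compact `K ⊆ X`. Finitely many separators between a point and the complement
of a neighborhood enclose a smaller neighborhood whose frontier lies in their union. The traces of
the separators on `K` are compact, hence `D`-colored, so the frontier is too, and `K` has a `(D +
1)`-coloring. -/

open Set Topology TopologicalSpace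

/-! ### Strongly zero-dimensional spaces: heredity and sum theorems -/

/-- Any two disjoint closed subsets can be separated by a clopen set. -/
def StronglyZeroDimensional (Y : Type*) [TopologicalSpace Y] : Prop :=
  ∀ A B : Set Y, IsClosed A → IsClosed B → Disjoint A B →
    ∃ C : Set Y, IsClopen C ∧ A ⊆ C ∧ Disjoint C B

namespace StronglyZeroDimensional

variable {X Y : Type*} [TopologicalSpace X] [TopologicalSpace Y]

theorem of_isEmpty [IsEmpty X] : StronglyZeroDimensional X := fun _ _ _ _ _ ↦
  ⟨∅, isClopen_empty, fun x ↦ (IsEmpty.false x).elim, disjoint_bot_left⟩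

theorem of_isClosedEmbedding (h : StronglyZeroDimensional X) {f : Y → X}
    (hf : IsClosedEmbedding f) : StronglyZeroDimensional Y := by
  intro A B hA hB hAB
  obtain ⟨C, hC, hAC, hCB⟩ := h (f '' A) (f '' B) (hf.isClosedMap _ hA) (hf.isClosedMap _ hB)
    ((disjoint_image_iff hf.injective).2 hAB)
  refine ⟨f ⁻¹' C, hC.preimage hf.continuous, image_subset_iff.1 hAC, ?_⟩
  rw [Set.disjoint_left] at hCB ⊢
  exact fun x hx hxB ↦ hCB hx (mem_image_of_mem f hxB)

theorem isTopologicalBasis_isClopen [T1Space X] (h : StronglyZeroDimensional X) :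
    IsTopologicalBasis {s : Set X | IsClopen s} := by
  refine isTopologicalBasis_of_isOpen_of_nhds (fun u hu ↦ hu.isOpen) fun x U hx hU ↦ ?_
  obtain ⟨C, hC, hxC, hCU⟩ := h {x} Uᶜ isClosed_singleton hU.isClosed_compl
    (by simpa using hx)
  exact ⟨C, hC, by simpa using hxC, disjoint_compl_right_iff_subset.1 hCU⟩

/-- Countably many clopen sets, each missing `A` or `B`, cover the space. Making them disjoint gives
an open partition, and the pieces missing `B` form the required clopen set. -/
theorem of_isTopologicalBasis_isClopen [SecondCountableTopology X]
    (h : IsTopologicalBasis {s : Set X | IsClopen s}) : StronglyZeroDimensional X := by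
  intro A B hA hB hAB
  have key : ∀ x : X, ∃ C : Set X, IsClopen C ∧ x ∈ C ∧ (Disjoint C A ∨ Disjoint C B) := by
    intro x
    by_cases hx : x ∈ A
    · obtain ⟨C, hC, hxC, hCB⟩ := h.exists_subset_of_mem_open
        (show x ∈ Bᶜ from Set.disjoint_left.1 hAB hx) hB.isOpen_compl
      exact ⟨C, hC, hxC, .inr (disjoint_left.2 hCB)⟩
    · obtain ⟨C, hC, hxC, hCA⟩ := h.exists_subset_of_mem_open (show x ∈ Aᶜ from hx)
        hA.isOpen_compl
      exact ⟨C, hC, hxC, .inl (disjoint_left.2 hCA)⟩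
  choose C hC hxC hCAB using key
  obtain ⟨t, ht, htU⟩ := TopologicalSpace.countable_cover_nhds
    (fun x ↦ (hC x).isOpen.mem_nhds (hxC x))
  rcases isEmpty_or_nonempty X with hX | ⟨⟨x₀⟩⟩
  · exact of_isEmpty A B hA hB hAB
  have hne : t.Nonempty := by
    have : x₀ ∈ ⋃ x ∈ t, C x := htU ▸ mem_univ _
    simp only [mem_iUnion] at this
    obtain ⟨y, hy, -⟩ := this
    exact ⟨y, hy⟩
  obtain ⟨e, rfl⟩ := ht.exists_eq_range hne
  have hcov : ⋃ n, C (e n) = univ := by simpa using htU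
  set E : ℕ → Set X := disjointed fun n ↦ C (e n) with hE
  have hEo : ∀ n, IsOpen (E n) := fun n ↦ by
    rw [hE, disjointed_apply]
    refine (hC _).isOpen.sdiff ?_
    rw [Finset.sup_set_eq_biUnion]
    exact isClosed_biUnion_finset fun i _ ↦ (hC _).isClosed
  have hEcov : ⋃ n, E n = univ := by rw [hE, iUnion_disjointed, hcov]
  have hEd : Pairwise (Function.onFun Disjoint E) := disjoint_disjointed _
  have hsub : ∀ n, E n ⊆ C (e n) := fun n ↦ disjointed_subset _ n
  have hcompl : (⋃ n ∈ {n | Disjoint (E n) B}, E n)ᶜ = ⋃ n ∈ {n | ¬ Disjoint (E n) B}, E n := by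
    ext x
    obtain ⟨n, hn⟩ := mem_iUnion.1 (hEcov ▸ mem_univ x : x ∈ ⋃ n, E n)
    have huniq : ∀ m, x ∈ E m → m = n := fun m hm ↦ by
      by_contra hmn
      exact Set.disjoint_left.1 (hEd hmn) hm hn
    simp only [mem_compl_iff, mem_iUnion, mem_ofPred_eq, exists_prop, not_exists, not_and]
    constructor
    · exact fun hx ↦ ⟨n, fun hd ↦ hx n hd hn, hn⟩
    · rintro ⟨m, hm, hxm⟩ k hk hxk
      exact hm (huniq m hxm ▸ huniq k hxk ▸ hk)
  refine ⟨⋃ n ∈ {n | Disjoint (E n) B}, E n, ⟨?_, ?_⟩, ?_, ?_⟩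
  · rw [← isOpen_compl_iff, hcompl]
    exact isOpen_biUnion fun n _ ↦ hEo n
  · exact isOpen_biUnion fun n _ ↦ hEo n
  · intro x hx
    obtain ⟨n, hn⟩ := mem_iUnion.1 (hEcov ▸ mem_univ x : x ∈ ⋃ n, E n)
    refine mem_biUnion ?_ hn
    rcases hCAB (e n) with hd | hd
    · exact (Set.disjoint_left.1 hd (hsub n hn) hx).elim
    · exact hd.mono_left (hsub n)
  · simp only [mem_ofPred_eq, disjoint_iUnion_left]
    exact fun n hn ↦ hn

/-- Disjoint closed sets of a subspace need not extend to disjoint closed sets, but clopen bases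
restrict to arbitrary subspaces. -/
theorem of_isEmbedding [T1Space X] [SecondCountableTopology X] (h : StronglyZeroDimensional X)
    {f : Y → X} (hf : IsEmbedding f) : StronglyZeroDimensional Y := by
  have := hf.secondCountableTopology
  refine of_isTopologicalBasis_isClopen ?_
  refine IsTopologicalBasis.of_isOpen_of_subset (fun u hu ↦ hu.isOpen)
    (h.isTopologicalBasis_isClopen.isInducing hf.isInducing) ?_
  rintro _ ⟨C, hC, rfl⟩
  exact IsClopen.preimage hC hf.continuous

theorem of_mapsTo_isEmbedding [T1Space X] [SecondCountableTopology X] {f : Y → X}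
    (hf : IsEmbedding f) {Z : Set X} (h : StronglyZeroDimensional Z) {W : Set Y}
    (hW : MapsTo f W Z) : StronglyZeroDimensional W :=
  h.of_isEmbedding (hf.restrict hW)

theorem mono [T1Space X] [SecondCountableTopology X] {Z W : Set X}
    (h : StronglyZeroDimensional Z) (hWZ : W ⊆ Z) : StronglyZeroDimensional W :=
  of_mapsTo_isEmbedding IsEmbedding.id h hWZ

theorem preimage_isClosedEmbedding {f : Y → X} (hf : IsClosedEmbedding f) {Z : Set X}
    (h : StronglyZeroDimensional Z) : StronglyZeroDimensional (f ⁻¹' Z) :=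
  h.of_isClosedEmbedding (hf.restrictPreimage Z)

/-- The pair `(A, B)` is enlarged step by step through disjoint closed pairs, the `n`-th step
absorbing `F n`. In the limit the two sides are complementary. -/
theorem of_iUnion_isClosed_nat [NormalSpace X] {F : ℕ → Set X} (hF : ∀ n, IsClosed (F n))
    (hcov : ⋃ n, F n = univ) (h : ∀ n, StronglyZeroDimensional (F n)) :
    StronglyZeroDimensional X := by
  intro A B hA hB hAB
  let T := {p : Set X × Set X // IsClosed p.1 ∧ IsClosed p.2 ∧ Disjoint p.1 p.2}
  -- Landing in the interiors is what makes the increasing unions of closed sets open.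
  have step : ∀ (n : ℕ) (p : T), ∃ q : T, p.1.1 ⊆ interior q.1.1 ∧ p.1.2 ⊆ interior q.1.2 ∧
      F n ⊆ q.1.1 ∪ q.1.2 := by
    rintro n ⟨⟨P, Q⟩, hP, hQ, hPQ⟩
    obtain ⟨C, hC, hPC, hCQ⟩ := h n (Subtype.val ⁻¹' P) (Subtype.val ⁻¹' Q)
      (hP.preimage continuous_subtype_val) (hQ.preimage continuous_subtype_val)
      (hPQ.preimage _)
    have hC1 : IsClosed (Subtype.val '' C : Set X) :=
      (hF n).isClosedEmbedding_subtypeVal.isClosedMap _ hC.isClosed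
    have hC2 : IsClosed (Subtype.val '' Cᶜ : Set X) :=
      (hF n).isClosedEmbedding_subtypeVal.isClosedMap _ hC.compl.isClosed
    have hd : Disjoint (P ∪ Subtype.val '' C) (Q ∪ Subtype.val '' Cᶜ) := by
      rw [Set.disjoint_left]
      rintro x (hx | ⟨y, hy, rfl⟩) (hx' | ⟨z, hz, hzy⟩)
      · exact Set.disjoint_left.1 hPQ hx hx'
      · subst hzy
        exact hz (hPC hx)
      · exact Set.disjoint_left.1 hCQ hy hx'
      · exact hz (Subtype.val_injective hzy ▸ hy)
    obtain ⟨U, hU, hPU, hUQ⟩ := normal_exists_closure_subset (hP.union hC1)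
      (hQ.union hC2).isOpen_compl (disjoint_left.1 hd)
    obtain ⟨V, hV, hQV, hVU⟩ := normal_exists_closure_subset (hQ.union hC2)
      isClosed_closure.isOpen_compl (subset_compl_comm.1 hUQ)
    refine ⟨⟨(closure U, closure V), isClosed_closure, isClosed_closure,
      (disjoint_left.2 hVU).symm⟩, ?_, ?_, ?_⟩
    · exact (subset_union_left.trans hPU).trans (interior_maximal subset_closure hU)
    · exact (subset_union_left.trans hQV).trans (interior_maximal subset_closure hV)
    · intro x hx
      by_cases hxC : (⟨x, hx⟩ : F n) ∈ C
      · exact .inl (subset_closure (hPU (.inr ⟨_, hxC, rfl⟩)))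
      · exact .inr (subset_closure (hQV (.inr ⟨_, hxC, rfl⟩)))
  choose next hnext1 hnext2 hnext3 using step
  let s : ℕ → T := fun n ↦ Nat.rec ⟨(A, B), hA, hB, hAB⟩ next n
  have hs : ∀ n, s (n + 1) = next n (s n) := fun n ↦ rfl
  have m1 : Monotone fun n ↦ (s n).1.1 := monotone_nat_of_le_succ fun n ↦ by
    rw [hs]; exact (hnext1 n _).trans interior_subset
  have m2 : Monotone fun n ↦ (s n).1.2 := monotone_nat_of_le_succ fun n ↦ by
    rw [hs]; exact (hnext2 n _).trans interior_subset
  have o1 : IsOpen (⋃ n, (s n).1.1) := by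
    rw [isOpen_iff_mem_nhds]
    intro x hx
    obtain ⟨n, hn⟩ := mem_iUnion.1 hx
    exact Filter.mem_of_superset (mem_interior_iff_mem_nhds.1 (hnext1 n _ hn))
      (subset_iUnion (fun n ↦ (s n).1.1) (n + 1))
  have o2 : IsOpen (⋃ n, (s n).1.2) := by
    rw [isOpen_iff_mem_nhds]
    intro x hx
    obtain ⟨n, hn⟩ := mem_iUnion.1 hx
    exact Filter.mem_of_superset (mem_interior_iff_mem_nhds.1 (hnext2 n _ hn))
      (subset_iUnion (fun n ↦ (s n).1.2) (n + 1))
  have hd : Disjoint (⋃ n, (s n).1.1) (⋃ n, (s n).1.2) := by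
    rw [Set.disjoint_left]
    intro x hx hx'
    obtain ⟨n, hn⟩ := mem_iUnion.1 hx
    obtain ⟨m, hm⟩ := mem_iUnion.1 hx'
    exact Set.disjoint_left.1 (s (max n m)).2.2.2 (m1 (le_max_left n m) hn)
      (m2 (le_max_right n m) hm)
  have hc : (⋃ n, (s n).1.1)ᶜ = ⋃ n, (s n).1.2 := by
    refine subset_antisymm (fun x hx ↦ ?_) (subset_compl_iff_disjoint_left.2 hd)
    obtain ⟨n, hn⟩ := mem_iUnion.1 (hcov ▸ mem_univ x : x ∈ ⋃ n, F n)
    rcases hnext3 n (s n) hn with h1 | h2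
    · exact (hx (mem_iUnion.2 ⟨n + 1, h1⟩)).elim
    · exact mem_iUnion.2 ⟨n + 1, h2⟩
  refine ⟨⋃ n, (s n).1.1, ⟨?_, o1⟩, subset_iUnion (fun n ↦ (s n).1.1) 0,
    hd.mono_right (subset_iUnion (fun n ↦ (s n).1.2) 0)⟩
  rw [← isOpen_compl_iff, hc]
  exact o2

theorem of_iUnion_isClosed {ι : Type*} [Countable ι] [NormalSpace X] {F : ι → Set X}
    (hF : ∀ i, IsClosed (F i)) (hcov : ⋃ i, F i = univ)
    (h : ∀ i, StronglyZeroDimensional (F i)) : StronglyZeroDimensional X := by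
  rcases isEmpty_or_nonempty ι with hι | hι
  · have : IsEmpty X := ⟨fun x ↦ by simpa using (hcov ▸ mem_univ x : x ∈ ⋃ i, F i)⟩
    exact of_isEmpty
  obtain ⟨e, he⟩ := exists_surjective_nat ι
  exact of_iUnion_isClosed_nat (fun n ↦ hF (e n)) (by rw [← hcov]; exact he.iUnion_comp F)
    fun n ↦ h (e n)

/-- The countable sum theorem for the traces on `Z` of closed sets of the ambient space. -/
theorem of_subset_iUnion_isClosed {ι : Type*} [Countable ι] {Z : Set X} [NormalSpace Z]
    {F : ι → Set X} (hF : ∀ i, IsClosed (F i)) (hcov : Z ⊆ ⋃ i, F i)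
    (h : ∀ i, StronglyZeroDimensional (Z ∩ F i : Set X)) : StronglyZeroDimensional Z := by
  refine of_iUnion_isClosed (F := fun i ↦ (Subtype.val ⁻¹' F i : Set Z))
    (fun i ↦ (hF i).preimage continuous_subtype_val) ?_ fun i ↦ ?_
  · rw [← preimage_iUnion, preimage_eq_univ_iff, Subtype.range_coe]
    exact hcov
  · have hm : MapsTo (Subtype.val : Z → X) (Subtype.val ⁻¹' F i) (Z ∩ F i) := fun x hx ↦ ⟨x.2, hx⟩
    refine (h i).of_isClosedEmbedding ⟨IsEmbedding.subtypeVal.restrict hm, ?_⟩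
    convert isClosed_univ
    ext ⟨x, hx⟩
    simp only [mem_range, mem_univ, iff_true]
    exact ⟨⟨⟨x, hx.1⟩, hx.2⟩, rfl⟩

/-- A space partitioned by clopen strongly zero-dimensional sets is strongly zero-dimensional. -/
theorem of_isLocallyConstant {ι : Type*} {p : X → ι} (hp : IsLocallyConstant p)
    (h : ∀ i, StronglyZeroDimensional (p ⁻¹' {i})) : StronglyZeroDimensional X := by
  intro A B hA hB hAB
  choose C hC hAC hCB using fun i ↦ h i (Subtype.val ⁻¹' A) (Subtype.val ⁻¹' B)
    (hA.preimage continuous_subtype_val) (hB.preimage continuous_subtype_val) (hAB.preimage _)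
  have hmem : ∀ x : X, x ∈ (⋃ i, Subtype.val '' C i) ↔ (⟨x, rfl⟩ : p ⁻¹' {p x}) ∈ C (p x) := by
    intro x
    simp only [mem_iUnion, mem_image, Subtype.exists]
    constructor
    · rintro ⟨i, y, hy, hyC, rfl⟩
      obtain rfl : p y = i := hy
      exact hyC
    · exact fun hx ↦ ⟨p x, x, rfl, hx, rfl⟩
  have hopen : ∀ D : ∀ i, Set (p ⁻¹' {i}), (∀ i, IsOpen (D i)) →
      IsOpen (⋃ i, Subtype.val '' D i) := fun D hD ↦ isOpen_iUnion fun i ↦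
    (hp.isOpen_fiber i).isOpenEmbedding_subtypeVal.isOpenMap _ (hD i)
  refine ⟨⋃ i, Subtype.val '' C i, ⟨?_, hopen C fun i ↦ (hC i).isOpen⟩, fun x hx ↦ ?_, ?_⟩
  · rw [← isOpen_compl_iff]
    convert hopen (fun i ↦ (C i)ᶜ) fun i ↦ (hC i).compl.isOpen
    ext x
    rw [mem_compl_iff, hmem]
    simp only [mem_iUnion, mem_image, Subtype.exists]
    constructor
    · exact fun hx ↦ ⟨p x, x, rfl, hx, rfl⟩
    · rintro ⟨i, y, hy, hyC, rfl⟩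
      obtain rfl : p y = i := hy
      exact hyC
  · rw [hmem]
    exact hAC _ hx
  · rw [Set.disjoint_left]
    intro x hx
    rw [hmem] at hx
    exact Set.disjoint_left.1 (hCB _) hx

end StronglyZeroDimensional

/-! ### Colorings by zero-dimensional sets -/

/-- `Y` is partitioned into `n` (possibly empty) strongly zero-dimensional subsets. -/
def HasZeroDimensionalColoring (n : ℕ) (Y : Type*) [TopologicalSpace Y] : Prop :=
  ∃ c : Y → Fin n, ∀ i, StronglyZeroDimensional (c ⁻¹' {i})

namespace HasZeroDimensionalColoring

theorem isEmpty {Y : Type*} [TopologicalSpace Y] (h : HasZeroDimensionalColoring 0 Y) :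
    IsEmpty Y :=
  let ⟨c, _⟩ := h
  ⟨fun y ↦ (c y).elim0⟩

theorem of_isEmpty (n : ℕ) {Y : Type*} [TopologicalSpace Y] [IsEmpty Y] :
    HasZeroDimensionalColoring n Y :=
  ⟨fun y ↦ isEmptyElim y, fun _ ↦ .of_isEmpty⟩

theorem of_isEmbedding {X Y : Type*} [TopologicalSpace X] [TopologicalSpace Y] [T1Space X]
    [SecondCountableTopology X] {n : ℕ} (h : HasZeroDimensionalColoring n X) {f : Y → X}
    (hf : IsEmbedding f) : HasZeroDimensionalColoring n Y := by
  obtain ⟨c, hc⟩ := h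
  exact ⟨c ∘ f, fun i ↦ .of_mapsTo_isEmbedding hf (hc i) fun x hx ↦ hx⟩

/-- Each point takes its color from the first `F i` containing it. The part of `F i` outside the
earlier sets is a countable union of closed sets, so the sum theorem applies to each color class. -/
theorem of_iUnion_isClosed_nat {X : Type*} [MetricSpace X] [SecondCountableTopology X] {n : ℕ}
    {F : ℕ → Set X} (hF : ∀ i, IsClosed (F i)) (hcov : ⋃ i, F i = univ)
    (h : ∀ i, HasZeroDimensionalColoring n (F i)) : HasZeroDimensionalColoring n X := by
  classical
  choose c hc using h
  have hex : ∀ x, ∃ i, x ∈ F i := fun x ↦ mem_iUnion.1 (hcov ▸ mem_univ x)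
  have hG : ∀ i, IsOpen (⋃ m ∈ Finset.range i, F m)ᶜ := fun i ↦
    (isClosed_biUnion_finset fun m _ ↦ hF m).isOpen_compl
  choose G hGc hGs hGU _ using fun i ↦ (hG i).exists_iUnion_isClosed
  have hfind : ∀ x i m, x ∈ F i → x ∈ G i m → Nat.find (hex x) = i := by
    intro x i m hx hxG
    refine (Nat.find_eq_iff _).2 ⟨hx, fun k hk hxk ↦ hGs i m hxG ?_⟩
    exact mem_biUnion (by simpa using hk) hxk
  refine ⟨fun x ↦ c (Nat.find (hex x)) ⟨x, Nat.find_spec (hex x)⟩, fun j ↦ ?_⟩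
  refine StronglyZeroDimensional.of_subset_iUnion_isClosed (F := fun p : ℕ × ℕ ↦
    F p.1 ∩ G p.1 p.2) (fun p ↦ (hF _).inter (hGc _ _)) (fun x _ ↦ ?_) fun p ↦ ?_
  · have hx : x ∈ (⋃ m ∈ Finset.range (Nat.find (hex x)), F m)ᶜ := by
      simp only [mem_compl_iff, mem_iUnion, not_exists, Finset.mem_range]
      exact fun m hm ↦ Nat.find_min (hex x) hm
    rw [← hGU] at hx
    obtain ⟨m, hm⟩ := mem_iUnion.1 hx
    exact mem_iUnion.2 ⟨(Nat.find (hex x), m), Nat.find_spec (hex x), hm⟩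
  · have hmem : ∀ x : ((fun x ↦ c (Nat.find (hex x)) ⟨x, Nat.find_spec (hex x)⟩) ⁻¹' {j} ∩
        (F p.1 ∩ G p.1 p.2) : Set X), (⟨x.1, x.2.2.1⟩ : F p.1) ∈ c p.1 ⁻¹' {j} := by
      rintro ⟨x, hx, hxF, hxG⟩
      have hi := hfind x p.1 p.2 hxF hxG
      have key : ∀ k (hk : x ∈ F k), k = p.1 → c k ⟨x, hk⟩ = c p.1 ⟨x, hxF⟩ := by
        rintro k hk rfl
        rfl
      exact (key _ _ hi).symm.trans hx
    refine (hc p.1 j).of_isEmbedding (f := fun x ↦ ⟨⟨x.1, x.2.2.1⟩, hmem x⟩) ?_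
    exact IsEmbedding.of_comp (g := fun y ↦ y.1.1) (by fun_prop) (by fun_prop)
      IsEmbedding.subtypeVal

theorem of_iUnion_isClosed {ι X : Type*} [Countable ι] [MetricSpace X]
    [SecondCountableTopology X] {n : ℕ} {F : ι → Set X} (hF : ∀ i, IsClosed (F i))
    (hcov : ⋃ i, F i = univ) (h : ∀ i, HasZeroDimensionalColoring n (F i)) :
    HasZeroDimensionalColoring n X := by
  rcases isEmpty_or_nonempty ι with hι | hι
  · have : IsEmpty X := ⟨fun x ↦ by simpa using (hcov ▸ mem_univ x : x ∈ ⋃ i, F i)⟩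
    exact of_isEmpty n
  obtain ⟨e, he⟩ := exists_surjective_nat ι
  exact of_iUnion_isClosed_nat (fun n ↦ hF (e n)) (by rw [← hcov]; exact he.iUnion_comp F)
    fun n ↦ h (e n)

/-- The countable sum theorem for a subset `S` covered by closed sets of the ambient space. -/
theorem of_subset_iUnion_isClosed {ι X : Type*} [Countable ι] [MetricSpace X] {n : ℕ} {S : Set X}
    [SecondCountableTopology S] {F : ι → Set X} (hF : ∀ i, IsClosed (F i)) (hcov : S ⊆ ⋃ i, F i)
    (h : ∀ i, HasZeroDimensionalColoring n (F i))
    (hsc : ∀ i, SecondCountableTopology (F i)) : HasZeroDimensionalColoring n S := by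
  refine of_iUnion_isClosed (F := fun i ↦ (Subtype.val ⁻¹' F i : Set S))
    (fun i ↦ (hF i).preimage continuous_subtype_val) ?_ fun i ↦ ?_
  · rw [← preimage_iUnion, preimage_eq_univ_iff, Subtype.range_coe]
    exact hcov
  · have hm : MapsTo (Subtype.val : S → X) (Subtype.val ⁻¹' F i) (F i) := fun x hx ↦ hx
    exact (h i).of_isEmbedding (IsEmbedding.subtypeVal.restrict hm)

end HasZeroDimensionalColoring

/-! ### Separation and refinement along a zero-dimensional subset -/

section Separation

variable {X : Type*} [TopologicalSpace X]

/-- A strongly zero-dimensional subset can be split, compatibly with two closed sets disjoint on it,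
into two parts neither of which meets the closure of the other. -/
theorem StronglyZeroDimensional.exists_clopen_split {Z : Set X}
    (h : StronglyZeroDimensional Z) {A B : Set X} (hA : IsClosed A) (hB : IsClosed B)
    (hAB : Disjoint (Z ∩ A) B) :
    ∃ C D : Set X, C ∪ D = Z ∧ Disjoint C D ∧ Z ∩ A ⊆ C ∧ Z ∩ B ⊆ D ∧
      Disjoint (closure C) D ∧ Disjoint C (closure D) := by
  obtain ⟨C, hC, hAC, hCB⟩ := h (Subtype.val ⁻¹' A) (Subtype.val ⁻¹' B)
    (hA.preimage continuous_subtype_val) (hB.preimage continuous_subtype_val) (by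
      rw [Set.disjoint_left] at hAB ⊢
      exact fun x hx ↦ hAB ⟨x.2, hx⟩)
  have hcl : ∀ E : Set Z, IsClosed E →
      Disjoint (closure (Subtype.val '' E)) (Subtype.val '' Eᶜ : Set X) := by
    intro E hE
    rw [Set.disjoint_left]
    rintro _ hx ⟨y, hy, rfl⟩
    rw [← hE.closure_eq, IsEmbedding.subtypeVal.closure_eq_preimage_closure_image] at hy
    exact hy hx
  refine ⟨Subtype.val '' C, Subtype.val '' Cᶜ, ?_, ?_, ?_, ?_, hcl C hC.isClosed, ?_⟩
  · rw [← image_union, union_compl_self, image_univ, Subtype.range_coe]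
  · exact (disjoint_image_iff Subtype.val_injective).2 disjoint_compl_right
  · exact fun x hx ↦ ⟨⟨x, hx.1⟩, hAC hx.2, rfl⟩
  · exact fun x hx ↦ ⟨⟨x, hx.1⟩, fun hxC ↦ Set.disjoint_left.1 hCB hxC hx.2, rfl⟩
  · have := (hcl Cᶜ hC.compl.isClosed).symm
    rwa [compl_compl] at this

theorem StronglyZeroDimensional.exists_isOpen_disjoint_frontier [T5Space X] {M : Set X}
    (h : StronglyZeroDimensional M) {A V : Set X} (hA : IsClosed A) (hV : IsOpen V)
    (hAV : A ⊆ V) : ∃ U, IsOpen U ∧ A ⊆ U ∧ U ⊆ V ∧ Disjoint (frontier U) M := by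
  -- `M` is split relative to closed neighborhoods of `A` and `Vᶜ`, so that `C` stays away from `Vᶜ`
  -- and `D` from `A`. Then `A ∪ C` and `Vᶜ ∪ D` are separated, and complete normality applies.
  obtain ⟨U₁, hU₁, hAU₁, hU₁V⟩ := normal_exists_closure_subset hA hV hAV
  obtain ⟨V₁, hV₁, hBV₁, hV₁U⟩ := normal_exists_closure_subset hV.isClosed_compl
    isClosed_closure.isOpen_compl (compl_subset_compl.2 hU₁V)
  obtain ⟨C, D, rfl, hCD, hAC, hBD, hCD', hCD''⟩ := h.exists_clopen_split
    (A := closure U₁) (B := closure V₁) isClosed_closure isClosed_closure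
    ((disjoint_left.2 hV₁U).symm.mono_left inter_subset_right)
  have hCV : Disjoint C V₁ := by
    rw [Set.disjoint_left]
    exact fun x hx hxV ↦ Set.disjoint_left.1 hCD hx (hBD ⟨.inl hx, subset_closure hxV⟩)
  have hDU : Disjoint D U₁ := by
    rw [Set.disjoint_left]
    exact fun x hx hxU ↦ Set.disjoint_left.1 hCD (hAC ⟨.inr hx, subset_closure hxU⟩) hx
  have hAB : Disjoint A Vᶜ := disjoint_compl_right_iff_subset.2 hAV
  have key : SeparatedNhds (A ∪ C) (Vᶜ ∪ D) := by
    refine separatedNhds_iff_disjoint.2 (completely_normal ?_ ?_)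
    · rw [closure_union, hA.closure_eq, disjoint_union_left, disjoint_union_right,
        disjoint_union_right]
      exact ⟨⟨hAB, hDU.symm.mono_left hAU₁⟩, (hCV.closure_left hV₁).mono_right hBV₁, hCD'⟩
    · rw [closure_union, hV.isClosed_compl.closure_eq, disjoint_union_left, disjoint_union_right,
        disjoint_union_right]
      exact ⟨⟨hAB, (hDU.closure_left hU₁).symm.mono_left hAU₁⟩, hCV.mono_right hBV₁, hCD''⟩
  obtain ⟨U, W, hU, hW, hACU, hBDW, hUW⟩ := key
  refine ⟨U, hU, subset_union_left.trans hACU, fun x hx ↦ ?_, ?_⟩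
  · by_contra hxV
    exact Set.disjoint_left.1 hUW hx (hBDW (.inl hxV))
  · rw [hU.frontier_eq, Set.disjoint_left]
    rintro x ⟨hx, hxU⟩ (hxC | hxD)
    · exact hxU (hACU (.inr hxC))
    · exact Set.disjoint_left.1 (hUW.closure_left hW) hx (hBDW (.inr hxD))

/-- By induction on the cover, `Z` splits into `C` inside `U a` and `D` inside the other members.
Disjoint open sets around them keep the new member disjoint from those found for `D`. -/
theorem StronglyZeroDimensional.exists_disjoint_isOpen_refinement [T5Space X] {ι : Type*}
    (s : Finset ι) : ∀ {Z : Set X}, StronglyZeroDimensional Z → ∀ {U : ι → Set X},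
    (∀ i ∈ s, IsOpen (U i)) → Z ⊆ ⋃ i ∈ s, U i →
    ∃ V : ι → Set X, (∀ i ∈ s, IsOpen (V i)) ∧ (∀ i ∈ s, V i ⊆ U i) ∧ Z ⊆ ⋃ i ∈ s, V i ∧
      (s : Set ι).PairwiseDisjoint V := by
  classical
  induction s using Finset.induction_on with
  | empty => exact fun {Z} _ {U} _ hZ ↦ ⟨U, by simp, by simp, by simpa using hZ, by simp⟩
  | insert a s ha ih =>
    intro Z h U hU hZ
    have hUa : IsOpen (U a) := hU a (Finset.mem_insert_self a s)
    have hUs : ∀ i ∈ s, IsOpen (U i) := fun i hi ↦ hU i (Finset.mem_insert_of_mem hi)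
    have hW : IsOpen (⋃ i ∈ s, U i) := isOpen_biUnion hUs
    rw [Finset.set_biUnion_insert] at hZ
    obtain ⟨C, D, hCDZ, hCD, hAC, hBD, hCD', hCD''⟩ := h.exists_clopen_split
      (A := (⋃ i ∈ s, U i)ᶜ) (B := (U a)ᶜ) hW.isClosed_compl hUa.isClosed_compl (by
        rw [Set.disjoint_left]
        rintro x ⟨hxZ, hx⟩ hxa
        exact (hZ hxZ).elim hxa hx)
    have hCU : C ⊆ U a := fun x hx ↦ by
      by_contra hxa
      exact Set.disjoint_left.1 hCD hx (hBD ⟨hCDZ ▸ .inl hx, hxa⟩)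
    have hDU : D ⊆ ⋃ i ∈ s, U i := fun x hx ↦ by
      by_contra hxa
      exact Set.disjoint_left.1 hCD (hAC ⟨hCDZ ▸ .inr hx, hxa⟩) hx
    obtain ⟨G, H, hG, hH, hCG, hDH, hGH⟩ :=
      separatedNhds_iff_disjoint.2 (completely_normal hCD' hCD'')
    have hD : StronglyZeroDimensional D := by
      have hDZ : D ⊆ Z := hCDZ ▸ subset_union_right
      refine h.of_isClosedEmbedding ⟨IsEmbedding.inclusion hDZ, ?_⟩
      rw [range_inclusion]
      -- `D` is closed in `Z` because `C` misses the closure of `D`.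
      convert (isClosed_closure (s := D)).preimage (continuous_subtype_val (p := (· ∈ Z)))
      ext ⟨x, hx⟩
      refine ⟨fun hxD ↦ subset_closure hxD, fun hxD ↦ ?_⟩
      rcases (hCDZ ▸ hx : x ∈ C ∪ D) with hxC | hxD'
      · exact (Set.disjoint_left.1 hCD'' hxC hxD).elim
      · exact hxD'
    obtain ⟨V, hV, hVU, hDV, hVd⟩ := ih hD (U := fun i ↦ U i ∩ H)
      (fun i hi ↦ (hUs i hi).inter hH) (fun x hx ↦ by
        obtain ⟨i, hi, hxi⟩ := mem_iUnion₂.1 (hDU hx)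
        exact mem_iUnion₂.2 ⟨i, hi, hxi, hDH hx⟩)
    have hne : ∀ i ∈ s, i ≠ a := fun i hi hia ↦ ha (hia ▸ hi)
    refine ⟨Function.update V a (U a ∩ G), fun i hi ↦ ?_, fun i hi ↦ ?_, ?_, ?_⟩
    · rcases Finset.mem_insert.1 hi with rfl | hi
      · simpa using hUa.inter hG
      · simpa [hne i hi] using hV i hi
    · rcases Finset.mem_insert.1 hi with rfl | hi
      · simp
      · simpa [hne i hi] using (hVU i hi).trans inter_subset_left
    · intro x hx
      rcases (hCDZ ▸ hx : x ∈ C ∪ D) with hxC | hxD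
      · exact mem_iUnion₂.2 ⟨a, Finset.mem_insert_self a s, by simpa using ⟨hCU hxC, hCG hxC⟩⟩
      · obtain ⟨i, hi, hxi⟩ := mem_iUnion₂.1 (hDV hxD)
        exact mem_iUnion₂.2 ⟨i, Finset.mem_insert_of_mem hi, by simpa [hne i hi] using hxi⟩
    · have hdis : ∀ i ∈ s, Disjoint (V i) (U a ∩ G) := fun i hi ↦
        (hGH.mono inter_subset_right ((hVU i hi).trans inter_subset_right)).symm
      rw [Finset.coe_insert, Set.pairwiseDisjoint_insert_of_notMem (by simpa using ha)]
      refine ⟨fun i hi j hj hij ↦ ?_, fun i hi ↦ ?_⟩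
      · simpa [Function.onFun, hne i hi, hne j hj] using hVd hi hj hij
      · simpa [hne i hi] using (hdis i hi).symm

end Separation

/-! ### Colorings versus `Ind`, `dim` and `ind` -/

section Consequences

/-- A frontier avoiding the last color is colored by the remaining `n`. -/
theorem HasZeroDimensionalColoring.hasLargeInductiveDimensionLT {n : ℕ} :
    ∀ {X : Type u} [TopologicalSpace X] [T5Space X], HasZeroDimensionalColoring n X →
      HasLargeInductiveDimensionLT n X := by
  induction n with
  | zero => exact fun h ↦ h.isEmpty
  | succ n ih =>
    intro X _ _ ⟨c, hc⟩ A V hA hV hAV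
    obtain ⟨U, hU, hAU, hUV, hd⟩ := (hc (Fin.last n)).exists_isOpen_disjoint_frontier hA hV hAV
    have hne : ∀ x : frontier U, c x ≠ Fin.last n := fun x hx ↦ Set.disjoint_left.1 hd x.2 hx
    refine ⟨U, hU, hAU, hUV, ih ⟨fun x ↦ (c x).castPred (hne x), fun i ↦ ?_⟩⟩
    have heq : (fun x : frontier U ↦ (c x).castPred (hne x)) ⁻¹' {i} =
        Subtype.val ⁻¹' (c ⁻¹' {i.castSucc}) := by
      ext x
      exact Fin.castPred_eq_iff_eq_castSucc (c x) (hne x) i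
    rw [heq]
    exact .preimage_isClosedEmbedding
      (isClosed_frontier (s := U)).isClosedEmbedding_subtypeVal (hc i.castSucc)

theorem HasZeroDimensionalColoring.hasCoveringDimensionLT {n : ℕ} {X : Type u}
    [TopologicalSpace X] [T5Space X] (h : HasZeroDimensionalColoring n X) :
    HasCoveringDimensionLT n X := by
  intro 𝒰 hfin hopen hcov
  obtain ⟨c, hc⟩ := h
  choose V hV hVU hZV hVd using fun j ↦ (hc j).exists_disjoint_isOpen_refinement hfin.toFinset
    (U := id) (fun U hU ↦ hopen U (by simpa using hU)) (fun x _ ↦ by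
      rw [← hfin.coe_toFinset, sUnion_eq_biUnion] at hcov
      exact hcov ▸ mem_univ x)
  simp only [Finite.mem_toFinset] at hV hVU hZV
  refine ⟨(fun p : Fin n × Set X ↦ V p.1 p.2) '' (univ ×ˢ 𝒰),
    (finite_univ.prod hfin).image _, ?_, ?_, ?_, fun x ↦ ?_⟩
  · rintro _ ⟨⟨j, U⟩, ⟨-, hU⟩, rfl⟩
    exact hV j U hU
  · refine eq_univ_of_forall fun x ↦ ?_
    obtain ⟨U, hU, hx⟩ := mem_iUnion₂.1 (hZV (c x) (show x ∈ c ⁻¹' {c x} from rfl))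
    exact ⟨_, ⟨(c x, U), ⟨mem_univ _, hU⟩, rfl⟩, hx⟩
  · rintro _ ⟨⟨j, U⟩, ⟨-, hU⟩, rfl⟩
    exact ⟨U, hU, hVU j U hU⟩
  · classical
    -- Each color contributes at most one member containing `x`. The value `∅` is harmless, since
    -- the range of `g` only has to contain these members.
    let g : Fin n → Set X := fun j ↦ if hj : ∃ U ∈ 𝒰, x ∈ V j U then V j hj.choose else ∅
    have hsub : {W ∈ (fun p : Fin n × Set X ↦ V p.1 p.2) '' (univ ×ˢ 𝒰) | x ∈ W} ⊆ range g := by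
      rintro _ ⟨⟨⟨j, U⟩, ⟨-, hU⟩, rfl⟩, hx⟩
      have hj : ∃ U ∈ 𝒰, x ∈ V j U := ⟨U, hU, hx⟩
      refine ⟨j, ?_⟩
      simp only [g, dif_pos hj]
      congr 1
      by_contra hne
      exact Set.disjoint_left.1 (hVd j (by simpa using hj.choose_spec.1) (by simpa using hU) hne)
        hj.choose_spec.2 hx
    calc _ ≤ (range g).encard := encard_le_encard hsub
      _ ≤ (univ : Set (Fin n)).encard := by rw [← image_univ]; exact encard_image_le _ _
      _ = n := by simp

theorem HasLargeInductiveDimensionLT.hasSmallInductiveDimensionLT {n : ℕ} :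
    ∀ {X : Type u} [TopologicalSpace X] [T1Space X], HasLargeInductiveDimensionLT n X →
      HasSmallInductiveDimensionLT X n := by
  induction n with
  | zero => exact fun h ↦ hasSmallInductiveDimensionLT_zero_iff.2 h
  | succ n ih =>
    intro X _ _ h
    refine .succ n {U | IsOpen U ∧ HasSmallInductiveDimensionLT (frontier U) n}
      (isTopologicalBasis_of_isOpen_of_nhds (fun U hU ↦ hU.1) fun x V hx hV ↦ ?_)
      fun U hU ↦ hU.2
    obtain ⟨U, hU, hxU, hUV, hf⟩ := h {x} V isClosed_singleton hV (by simpa using hx)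
    exact ⟨U, ⟨hU, ih hf⟩, by simpa using hxU, hUV⟩

theorem HasSmallInductiveDimensionLT.of_isEmbedding {n : ℕ} :
    ∀ {X Y : Type*} [TopologicalSpace X] [TopologicalSpace Y], HasSmallInductiveDimensionLT X n →
      ∀ {f : Y → X}, IsEmbedding f → HasSmallInductiveDimensionLT Y n := by
  induction n with
  | zero =>
    intro X Y _ _ h f hf
    have := hasSmallInductiveDimensionLT_zero_iff.1 h
    exact hasSmallInductiveDimensionLT_zero_iff.2 (Function.isEmpty f)
  | succ n ih =>
    intro X Y _ _ h f hf
    cases h with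
    | succ _ s hs h =>
      refine .succ n _ (hs.isInducing hf.isInducing) ?_
      rintro _ ⟨U, hU, rfl⟩
      exact ih (h U hU) (hf.restrict (hf.continuous.frontier_preimage_subset U))

/-- The frontiers of a countable base form an `n`-colored union by the sum theorem. On its
complement the base becomes clopen, so the complement can be the extra color. -/
theorem HasSmallInductiveDimensionLT.hasZeroDimensionalColoring {n : ℕ} :
    ∀ {X : Type u} [MetricSpace X] [SecondCountableTopology X],
      HasSmallInductiveDimensionLT X n → HasZeroDimensionalColoring n X := by
  induction n with
  | zero =>
    intro X _ _ h
    have := hasSmallInductiveDimensionLT_zero_iff.1 h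
    exact .of_isEmpty 0
  | succ n ih =>
    intro X _ _ h
    classical
    cases h with
    | succ _ s hs h =>
      obtain ⟨t, hts, htc, ht⟩ := hs.exists_countable
      have := htc.to_subtype
      have hY : HasZeroDimensionalColoring n (⋃ U : t, frontier (U : Set X) : Set X) :=
        .of_subset_iUnion_isClosed (fun U : t ↦ isClosed_frontier (s := (U : Set X))) Subset.rfl
          (fun U ↦ ih (h U (hts U.2))) fun U ↦ inferInstance
      have hZ : StronglyZeroDimensional ((⋃ U : t, frontier (U : Set X))ᶜ : Set X) := by
        refine .of_isTopologicalBasis_isClopen (IsTopologicalBasis.of_isOpen_of_subset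
          (fun u hu ↦ hu.isOpen) (ht.isInducing IsInducing.subtypeVal) ?_)
        rintro _ ⟨U, hU, rfl⟩
        rw [mem_ofPred_eq, isClopen_iff_frontier_eq_empty, eq_empty_iff_forall_notMem]
        intro x hx
        exact x.2 (mem_iUnion.2
          ⟨⟨U, hU⟩, continuous_subtype_val.frontier_preimage_subset U hx⟩)
      obtain ⟨c, hc⟩ := hY
      refine ⟨fun x ↦ if hx : x ∈ ⋃ U : t, frontier (U : Set X) then (c ⟨x, hx⟩).castSucc
        else Fin.last n, fun i ↦ ?_⟩
      induction i using Fin.lastCases with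
      | last =>
        refine hZ.mono fun x hx hxY ↦ ?_
        simp only [mem_preimage, mem_singleton_iff, dif_pos hxY] at hx
        exact Fin.castSucc_ne_last _ hx
      | cast i =>
        have hmem : ∀ x, (if hx : x ∈ ⋃ U : t, frontier (U : Set X) then (c ⟨x, hx⟩).castSucc
            else Fin.last n) = i.castSucc → ∃ hx : x ∈ ⋃ U : t, frontier (U : Set X),
            c ⟨x, hx⟩ = i := by
          intro x hx
          by_cases hxY : x ∈ ⋃ U : t, frontier (U : Set X)
          · rw [dif_pos hxY] at hx
            exact ⟨hxY, Fin.castSucc_injective _ hx⟩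
          · rw [dif_neg hxY] at hx
            exact (Fin.castSucc_ne_last _ hx.symm).elim
        refine (hc i).of_isEmbedding
          (f := fun x ↦ ⟨⟨x.1, (hmem x.1 x.2).1⟩, (hmem x.1 x.2).2⟩) ?_
        exact IsEmbedding.of_comp (g := fun y ↦ y.1.1) (by fun_prop) (by fun_prop)
          IsEmbedding.subtypeVal

end Consequences

/-! ### From covering dimension to colorings of compact metric spaces -/

/-- Finitely many vectors of `ℝⁿ` can be moved slightly into general position. -/
theorem exists_generalPosition_near {ι : Type*} {n : ℕ} (q : ι → Fin n → ℝ) {δ : ℝ} (hδ : 0 < δ)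
    (s : Finset ι) : ∃ p : ι → Fin n → ℝ, (∀ i, dist (p i) (q i) < δ) ∧
      ∀ t : Finset ι, t ⊆ s → t.card ≤ n → LinearIndepOn ℝ p (t : Set ι) := by
  classical
  induction s using Finset.induction_on with
  | empty =>
    refine ⟨q, fun i ↦ by simpa using hδ, fun t ht _ ↦ ?_⟩
    rw [Finset.subset_empty.1 ht, Finset.coe_empty]
    exact linearIndepOn_empty ℝ q
  | insert a s ha ih =>
    obtain ⟨p, hp, hind⟩ := ih
    -- Fewer than `n` vectors span a proper, hence null, subspace, so finitely many such spans
    -- cannot fill a ball.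
    have hnull : MeasureTheory.volume (⋃ t ∈ s.powerset.filter (·.card < n),
        (Submodule.span ℝ (p '' (t : Set ι)) : Set (Fin n → ℝ))) = 0 := by
      refine (MeasureTheory.measure_biUnion_null_iff (Finset.countable_toSet _)).2 fun t ht ↦ ?_
      refine MeasureTheory.Measure.addHaar_submodule _ _ fun htop ↦ ?_
      have h1 : Module.finrank ℝ (Submodule.span ℝ (p '' (t : Set ι))) ≤ t.card := by
        rw [← Finset.coe_image]
        exact (finrank_span_finset_le_card _).trans Finset.card_image_le
      rw [htop, finrank_top, Module.finrank_fin_fun] at h1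
      have h2 := (Finset.mem_filter.1 ht).2
      omega
    obtain ⟨v, hv, hvn⟩ : ∃ v ∈ Metric.ball (q a) δ, v ∉ ⋃ t ∈ s.powerset.filter (·.card < n),
        (Submodule.span ℝ (p '' (t : Set ι)) : Set (Fin n → ℝ)) := by
      by_contra! hsub
      exact (Metric.measure_ball_pos MeasureTheory.volume (q a) hδ).ne'
        (MeasureTheory.measure_mono_null hsub hnull)
    have hagree : ∀ t : Finset ι, t ⊆ s → EqOn p (Function.update p a v) t := by
      intro t ht i hi
      rw [Function.update_of_ne]
      rintro rfl
      exact ha (ht hi)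
    refine ⟨Function.update p a v, fun i ↦ ?_, fun t ht hcard ↦ ?_⟩
    · by_cases hi : i = a
      · subst hi
        simpa using hv
      · simpa [hi] using hp i
    · by_cases hat : a ∈ t
      · have hsub : t.erase a ⊆ s := by
          rw [← Finset.subset_insert_iff]
          exact ht
        have hcard' : (t.erase a).card < n :=
          (Finset.card_erase_lt_of_mem hat).trans_le hcard
        rw [← Finset.insert_erase hat, Finset.coe_insert]
        refine LinearIndepOn.insert ((hind _ hsub hcard'.le).congr (hagree _ hsub)) ?_
        rw [← (hagree _ hsub).image_eq, Function.update_self]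
        simp only [mem_iUnion, not_exists] at hvn
        exact hvn _ (Finset.mem_filter.2 ⟨Finset.mem_powerset.2 hsub, hcard'⟩)
      · have hsub : t ⊆ s := (Finset.subset_insert_iff_of_notMem hat).1 ht
        exact (hind t hsub hcard).congr (hagree t hsub)

/-- Maps into `ℝⁿ` of a compact space of covering dimension less than `n` can be moved slightly
off the origin. -/
theorem HasCoveringDimensionLT.exists_continuous_ne_zero_near {n : ℕ} {K : Type u}
    [TopologicalSpace K] [CompactSpace K] [T2Space K] (h : HasCoveringDimensionLT n K)
    {g : K → Fin n → ℝ} (hg : Continuous g) {ε : ℝ} (hε : 0 < ε) :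
    ∃ f : K → Fin n → ℝ, Continuous f ∧ (∀ x, dist (f x) (g x) < ε) ∧ ∀ x, f x ≠ 0 := by
  classical
  have hopen : ∀ x : K, IsOpen (g ⁻¹' Metric.ball (g x) (ε / 2)) :=
    fun x ↦ Metric.isOpen_ball.preimage hg
  obtain ⟨t, ht⟩ := CompactSpace.elim_nhds_subcover (fun x : K ↦ g ⁻¹' Metric.ball (g x) (ε / 2))
    fun x ↦ (hopen x).mem_nhds (by simpa using half_pos hε)
  obtain ⟨𝒱, hfin, hVo, hVcov, hVt, hcard⟩ := h
    ((fun x : K ↦ g ⁻¹' Metric.ball (g x) (ε / 2)) '' t) (t.finite_toSet.image _)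
    (by rintro _ ⟨x, -, rfl⟩; exact hopen x)
    (by rw [sUnion_image]; exact ht)
  have hcen : ∀ V : 𝒱, ∃ x : K, (V : Set K) ⊆ g ⁻¹' Metric.ball (g x) (ε / 2) := by
    rintro ⟨V, hV⟩
    obtain ⟨_, ⟨x, -, rfl⟩, hx⟩ := hVt V hV
    exact ⟨x, hx⟩
  choose z hz using hcen
  have := hfin.fintype
  obtain ⟨p, hp, hind⟩ := exists_generalPosition_near (fun V : 𝒱 ↦ g (z V)) (half_pos hε)
    Finset.univ
  obtain ⟨φ, hφ⟩ := PartitionOfUnity.exists_isSubordinate isClosed_univ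
    (fun V : 𝒱 ↦ (V : Set K)) (fun V ↦ hVo V V.2)
    (by rw [← sUnion_eq_iUnion, hVcov])
  have hsum : ∀ x, ∑ V, φ V x = 1 := fun x ↦ by
    rw [← finsum_eq_sum_of_fintype]
    exact φ.sum_eq_one (mem_univ x)
  have hsupp : ∀ V x, φ V x ≠ 0 → x ∈ (V : Set K) := fun V x hx ↦
    hφ V (subset_tsupport _ hx)
  refine ⟨fun x ↦ ∑ V, φ V x • p V, ?_, fun x ↦ ?_, fun x hx ↦ ?_⟩
  · exact continuous_finsetSum _ fun V _ ↦ (φ V).continuous.smul continuous_const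
  · have hmem : ∑ V ∈ Finset.univ.filter (fun V ↦ φ V x ≠ 0), φ V x • p V ∈
        Metric.ball (g x) ε := by
      refine (convex_ball (g x) ε).sum_mem (fun V _ ↦ φ.nonneg V x) ?_ fun V hV ↦ ?_
      · rw [Finset.sum_filter_ne_zero, hsum]
      · have hxV := hz V (hsupp V x (Finset.mem_filter.1 hV).2)
        rw [mem_preimage, Metric.mem_ball'] at hxV
        rw [Metric.mem_ball]
        linarith [dist_triangle (p V) (g (z V)) (g x), hp V]
    rw [Finset.sum_filter_of_ne (p := fun V ↦ φ V x ≠ 0)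
      (fun V _ hne h0 ↦ hne (by rw [h0, zero_smul]))] at hmem
    exact hmem
  · set T : Finset 𝒱 := Finset.univ.filter (fun V ↦ x ∈ (V : Set K)) with hT
    have hTcard : T.card ≤ n := by
      have h1 : ((T.map (Function.Embedding.subtype _) : Finset (Set K)) : Set (Set K)) ⊆
          {V ∈ 𝒱 | x ∈ V} := by
        intro V hV
        simp only [Finset.coe_map, mem_image, Finset.mem_coe, hT, Finset.mem_filter] at hV
        obtain ⟨W, ⟨-, hW⟩, rfl⟩ := hV
        exact ⟨W.2, hW⟩
      have h2 := (encard_le_encard h1).trans (hcard x)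
      rw [encard_coe_eq_coe_finsetCard, Finset.card_map] at h2
      exact_mod_cast h2
    -- At most `n` members contain `x`, so their vectors are independent. A zero of the map would
    -- kill all weights, yet these sum to `1`.
    have hli := linearIndepOn_finset_iff.1 (hind T (Finset.subset_univ _) hTcard)
      (fun V ↦ φ V x) (by
        rw [← hx, hT]
        refine Finset.sum_filter_of_ne fun V _ hne ↦ hsupp V x fun h0 ↦ hne ?_
        rw [h0, zero_smul])
    have hzero : ∀ V, φ V x = 0 := fun V ↦ by
      by_contra hne
      exact hne (hli V (Finset.mem_filter.2 ⟨Finset.mem_univ _, hsupp V x hne⟩))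
    simpa [hzero] using hsum x

open scoped BoundedContinuousFunction in
/-- On a compact space of covering dimension less than `n`, a sequence of functions can be moved
slightly so that no `n` of them have a common zero. -/
theorem HasCoveringDimensionLT.exists_seq_near {n : ℕ} {K : Type u} [TopologicalSpace K]
    [CompactSpace K] [T2Space K] (h : HasCoveringDimensionLT n K) (G : (ℕ × K) →ᵇ ℝ) {ε : ℝ}
    (hε : 0 < ε) : ∃ F : (ℕ × K) →ᵇ ℝ, dist F G < ε ∧
      ∀ s : Finset ℕ, s.card = n → ∀ x, ∃ k ∈ s, F (k, x) ≠ 0 := by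
  classical
  have hopen : ∀ s : {s : Finset ℕ // s.card = n},
      -- The complement is the projection, along the compact `K`, of a closed set.
      IsOpen {F : (ℕ × K) →ᵇ ℝ | ∀ x, ∃ k ∈ s.1, F (k, x) ≠ 0} := by
    intro s
    rw [← isClosed_compl_iff]
    have hcl : IsClosed (⋂ k ∈ s.1, {q : K × ((ℕ × K) →ᵇ ℝ) | q.2 (k, q.1) = 0}) := by
      refine isClosed_biInter fun k _ ↦ isClosed_eq ?_ continuous_const
      exact continuous_eval.comp (continuous_snd.prodMk (continuous_const.prodMk continuous_fst))
    convert isClosedMap_snd_of_compactSpace _ hcl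
    ext F
    simp
  have hdense : ∀ s : {s : Finset ℕ // s.card = n},
      Dense {F : (ℕ × K) →ᵇ ℝ | ∀ x, ∃ k ∈ s.1, F (k, x) ≠ 0} := by
    rintro ⟨s, hs⟩
    rw [Metric.dense_iff]
    intro F₀ r hr
    let e := s.equivFinOfCardEq hs
    obtain ⟨f, hf, hfd, hf0⟩ := h.exists_continuous_ne_zero_near
      (g := fun x i ↦ F₀ ((e.symm i : ℕ), x)) (by fun_prop) (half_pos hr)
    -- Only the `n` coordinates in `s` are changed, as a map to `ℝⁿ` moved off the origin.
    let H : ℕ × K → ℝ := fun q ↦ if hk : q.1 ∈ s then f q.2 (e ⟨q.1, hk⟩) else F₀ q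
    have hH : Continuous H := by
      refine continuous_prod_of_discrete_left.2 fun k ↦ ?_
      by_cases hk : k ∈ s
      · simp only [H, dif_pos hk]
        fun_prop
      · simp only [H, dif_neg hk]
        fun_prop
    have hHd : ∀ q, dist (H q) (F₀ q) ≤ r / 2 := by
      rintro ⟨k, x⟩
      by_cases hk : k ∈ s
      · simp only [H, dif_pos hk]
        have := (dist_le_pi_dist (f x) _ (e ⟨k, hk⟩)).trans (hfd x).le
        simpa using this
      · simp only [H, dif_neg hk, dist_self]
        positivity
    have hHb : ∀ q, ‖H q‖ ≤ r / 2 + ‖F₀‖ := fun q ↦ by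
      have h1 := norm_le_norm_add_norm_sub' (H q) (F₀ q)
      have h2 := F₀.norm_coe_le_norm q
      have h3 := hHd q
      rw [dist_eq_norm] at h3
      linarith
    refine ⟨BoundedContinuousFunction.ofNormedAddCommGroup H hH _ hHb, ?_, fun x ↦ ?_⟩
    · refine lt_of_le_of_lt ((BoundedContinuousFunction.dist_le (half_pos hr).le).2 hHd)
        (half_lt_self hr)
    · obtain ⟨i, hi⟩ := Function.ne_iff.1 (hf0 x)
      refine ⟨e.symm i, (e.symm i).2, ?_⟩
      simpa [H] using hi
  -- Baire category: there are only countably many `s`.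
  obtain ⟨F, hF, hFd⟩ := Metric.dense_iff.1 (dense_iInter_of_isOpen hopen hdense) G ε hε
  exact ⟨F, hF, fun s hs x ↦ mem_iInter.1 hFd ⟨s, hs⟩ x⟩

/-- The color of `x` is its number of zeros among functions `F (k, ·)` of which no `n` vanish
together. Where the zero set is exactly `T`, a function with `k ∉ T` has no zero, so its sign cuts
out a clopen set. The functions are chosen so that these sets form a base. -/
theorem HasCoveringDimensionLT.hasZeroDimensionalColoring {n : ℕ} {K : Type u} [MetricSpace K]
    [CompactSpace K] (h : HasCoveringDimensionLT n K) : HasZeroDimensionalColoring n K := by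
  classical
  rcases isEmpty_or_nonempty K with hK | hK
  · exact .of_isEmpty n
  obtain ⟨b, hb⟩ := (countable_countableBasis K).exists_eq_range
    (by
      obtain ⟨U, hU, -⟩ := (isBasis_countableBasis K).exists_subset_of_mem_open
        (mem_univ hK.some) isOpen_univ
      exact ⟨U, hU⟩)
  have hbasis : IsTopologicalBasis (range b) := hb ▸ isBasis_countableBasis K
  -- The index `k` encodes a pair of basic sets and a free counter, so each pair occurs infinitely
  -- often. Values `±1` keep their sign under a perturbation smaller than `1`.
  have hG : ∀ k : ℕ, ∃ g : C(K, ℝ), (∀ x, ‖g x‖ ≤ 1) ∧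
      (closure (b k.unpair.2.unpair.1) ⊆ b k.unpair.2.unpair.2 →
        (∀ x ∈ b k.unpair.2.unpair.1, g x = -1) ∧ ∀ x ∉ b k.unpair.2.unpair.2, g x = 1) := by
    intro k
    by_cases hk : closure (b k.unpair.2.unpair.1) ⊆ b k.unpair.2.unpair.2
    · obtain ⟨f, hf0, hf1, hf⟩ := exists_continuous_zero_one_of_isClosed
        (isClosed_closure (s := b k.unpair.2.unpair.1))
        (hbasis.isOpen (mem_range_self k.unpair.2.unpair.2)).isClosed_compl
        (disjoint_compl_right_iff_subset.2 hk)
      refine ⟨⟨fun x ↦ 2 * f x - 1, by fun_prop⟩, fun x ↦ ?_, fun _ ↦ ⟨fun x hx ↦ ?_,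
        fun x hx ↦ ?_⟩⟩
      · have := hf x
        rw [Real.norm_eq_abs, abs_le]
        constructor <;> simp only [ContinuousMap.coe_mk] <;> linarith [this.1, this.2]
      · simp [hf0 (subset_closure hx)]
      · have := hf1 hx
        simp only [ContinuousMap.coe_mk, this, Pi.one_apply]
        norm_num
    · exact ⟨0, by simp, fun hk' ↦ (hk hk').elim⟩
  choose g hgb hg using hG
  obtain ⟨F, hFG, hF⟩ := h.exists_seq_near (BoundedContinuousFunction.ofNormedAddCommGroup
    (fun q : ℕ × K ↦ g q.1 q.2)
    (continuous_prod_of_discrete_left.2 fun k ↦ (g k).continuous) 1 fun q ↦ hgb q.1 q.2) one_pos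
  have hnear : ∀ k x, |F (k, x) - g k x| < 1 := fun k x ↦ by
    have hlt := (BoundedContinuousFunction.dist_coe_le_dist (k, x)).trans_lt hFG
    rwa [Real.dist_eq] at hlt
  have hFk : ∀ k, Continuous fun x ↦ F (k, x) := fun k ↦ by fun_prop
  have hnsub : ∀ x, ∀ s : Finset ℕ, (s : Set ℕ) ⊆ {k | F (k, x) = 0} → s.card < n := by
    intro x s hs
    by_contra! hcard
    obtain ⟨t, hts, ht⟩ := Finset.exists_subset_card_eq hcard
    obtain ⟨k, hk, hne⟩ := hF t ht x
    exact hne (hs (hts hk))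
  have hfin : ∀ x, {k | F (k, x) = 0}.Finite := fun x ↦ by
    by_contra hinf
    obtain ⟨s, hs, hcard⟩ := Set.Infinite.exists_subset_card_eq hinf n
    exact (hnsub x s hs).ne hcard
  refine ⟨fun x ↦ ⟨(hfin x).toFinset.card, hnsub x _ (by simp)⟩, fun j ↦ ?_⟩
  refine StronglyZeroDimensional.of_subset_iUnion_isClosed
    (F := fun T : {T : Finset ℕ // T.card = j} ↦ ⋂ k ∈ T.1, {x | F (k, x) = 0})
    (fun T ↦ isClosed_biInter fun k _ ↦ isClosed_eq (hFk k) continuous_const) ?_ ?_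
  · intro x hx
    refine mem_iUnion.2 ⟨⟨(hfin x).toFinset, congrArg Fin.val hx⟩, ?_⟩
    simp
  · rintro ⟨T, hT⟩
    refine .of_isTopologicalBasis_isClopen (isTopologicalBasis_of_isOpen_of_nhds
      (fun u hu ↦ hu.isOpen) ?_)
    rintro ⟨x, hx⟩ U' hxU hU'
    obtain ⟨U, hU, rfl⟩ := isOpen_induced_iff.1 hU'
    obtain ⟨_, ⟨i₂, rfl⟩, hx₂, hU₂⟩ := hbasis.exists_subset_of_mem_open
      (show x ∈ U from hxU) hU
    obtain ⟨_, ⟨i₁, rfl⟩, hx₁, hU₁⟩ := hbasis.exists_closure_subset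
      ((hbasis.isOpen (mem_range_self i₂)).mem_nhds hx₂)
    -- The free counter gives an index for the pair outside the finite set `T`.
    obtain ⟨m, hm⟩ : ∃ m, Nat.pair m (Nat.pair i₁ i₂) ∉ T := by
      by_contra! hall
      refine Set.infinite_of_injective_forall_mem (f := fun m ↦ Nat.pair m (Nat.pair i₁ i₂))
        (fun m m' hmm ↦ (Nat.pair_eq_pair.1 hmm).1) hall T.finite_toSet
    set k := Nat.pair m (Nat.pair i₁ i₂) with hk
    have hgk := hg k
    simp only [hk, Nat.unpair_pair] at hgk
    rw [← hk] at hgk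
    obtain ⟨hneg, hpos⟩ := hgk hU₁
    have hne : ∀ y : ((fun x ↦ (⟨(hfin x).toFinset.card, hnsub x _ (by simp)⟩ : Fin n)) ⁻¹' {j} ∩
        ⋂ k ∈ T, {x | F (k, x) = 0} : Set K), F (k, y.1) ≠ 0 := by
      rintro ⟨y, hy, hyT⟩ h0
      have hsub : T ⊆ (hfin y).toFinset := fun l hl ↦ by
        simpa using mem_iInter₂.1 hyT l hl
      have heq := Finset.eq_of_subset_of_card_le hsub
        (by rw [hT]; exact (congrArg Fin.val hy).le)
      exact hm (heq ▸ (by simpa using h0))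
    refine ⟨{y | F (k, y.1) < 0}, ⟨?_, ?_⟩, ?_, ?_⟩
    · convert isClosed_le ((hFk k).comp continuous_subtype_val) continuous_const using 1
      ext y
      simp only [mem_ofPred_eq, Function.comp_apply]
      exact ⟨le_of_lt, fun hy ↦ lt_of_le_of_ne hy (hne y)⟩
    · exact isOpen_lt ((hFk k).comp continuous_subtype_val) continuous_const
    · have h1 := hnear k x
      rw [hneg x hx₁, abs_lt] at h1
      show F (k, x) < 0
      linarith [h1.2]
    · rintro ⟨y, hy⟩ (hlt : F (k, y) < 0)
      refine hU₂ ?_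
      by_contra hyb
      have h1 := hnear k y
      rw [hpos y hyb, abs_lt] at h1
      linarith [h1.1]

/-! ### From compact to locally compact spaces -/

/-- A locally compact metric space has a partition into clopen σ-compact sets. -/
theorem exists_isLocallyConstant_isSigmaCompact_fiber (X : Type u) [MetricSpace X]
    [LocallyCompactSpace X] : ∃ (ι : Type u) (p : X → ι), IsLocallyConstant p ∧
      ∀ i, IsSigmaCompact (p ⁻¹' {i}) := by
  choose K hK hKx using fun x : X ↦ exists_compact_mem_nhds x
  obtain ⟨v, hvo, hvc, hvf, hvK⟩ := precise_refinement (fun x ↦ interior (K x))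
    (fun x ↦ isOpen_interior)
    (eq_univ_of_forall fun x ↦ mem_iUnion.2 ⟨x, mem_interior_iff_mem_nhds.2 (hKx x)⟩)
  let r : X → X → Prop := fun x y ↦ ∃ a, x ∈ v a ∧ y ∈ v a
  have hp : IsLocallyConstant (Quot.mk r) := by
    refine (IsLocallyConstant.iff_exists_open _).2 fun x ↦ ?_
    obtain ⟨a, ha⟩ := mem_iUnion.1 (hvc ▸ mem_univ x : x ∈ ⋃ a, v a)
    exact ⟨v a, hvo a, ha, fun y hy ↦ Quot.sound ⟨a, hy, ha⟩⟩
  refine ⟨Quot r, Quot.mk r, hp, fun i ↦ ?_⟩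
  obtain ⟨x, rfl⟩ := Quot.exists_rep i
  -- `L n` stays compact because a compact set meets only finitely many `v a`. The union of the `L
  -- n` is closed under `r`, hence contains the whole class of `x`.
  let L : ℕ → Set X := fun n ↦ Nat.rec {x} (fun _ M ↦ ⋃ a ∈ {a | (v a ∩ M).Nonempty}, K a) n
  have hL : ∀ n, L (n + 1) = ⋃ a ∈ {a | (v a ∩ L n).Nonempty}, K a := fun n ↦ rfl
  have hLc : ∀ n, IsCompact (L n) := by
    intro n
    induction n with
    | zero => exact isCompact_singleton
    | succ n ih =>
      rw [hL]
      exact (hvf.finite_nonempty_inter_compact ih).isCompact_biUnion fun a _ ↦ hK a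
  have hstep : ∀ y z, r y z → y ∈ ⋃ n, L n → z ∈ ⋃ n, L n := by
    rintro y z ⟨a, hya, hza⟩ hy
    obtain ⟨n, hn⟩ := mem_iUnion.1 hy
    refine mem_iUnion.2 ⟨n + 1, ?_⟩
    rw [hL]
    exact mem_biUnion (show a ∈ {a | (v a ∩ L n).Nonempty} from ⟨y, hya, hn⟩)
      (interior_subset (hvK a hza))
  have hinv : ∀ y z, r y z → (y ∈ ⋃ n, L n) = (z ∈ ⋃ n, L n) := fun y z hyz ↦
    propext ⟨hstep y z hyz, hstep z y (let ⟨a, h₁, h₂⟩ := hyz; ⟨a, h₂, h₁⟩)⟩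
  refine ⟨fun n ↦ L n ∩ Quot.mk r ⁻¹' {Quot.mk r x},
    fun n ↦ (hLc n).inter_right (hp.isClosed_fiber _), ?_⟩
  rw [← iUnion_inter]
  refine inter_eq_right.2 fun y hy ↦ ?_
  have hxy : (y ∈ ⋃ n, L n) = (x ∈ ⋃ n, L n) :=
    congrArg (Quot.lift (fun y ↦ y ∈ ⋃ n, L n) hinv) hy
  rw [hxy]
  exact mem_iUnion.2 ⟨0, rfl⟩

/-- The sum theorem needs second countability, which only the σ-compact fibers supply. Their
colorings glue because the fibers are clopen. -/
theorem HasZeroDimensionalColoring.of_forall_isCompact {n : ℕ} {X : Type u} [MetricSpace X]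
    [LocallyCompactSpace X]
    (h : ∀ K : Set X, IsCompact K → HasZeroDimensionalColoring n K) :
    HasZeroDimensionalColoring n X := by
  obtain ⟨ι, p, hp, hσ⟩ := exists_isLocallyConstant_isSigmaCompact_fiber X
  have hfib : ∀ i, SecondCountableTopology (p ⁻¹' {i}) := fun i ↦ by
    have := isSigmaCompact_iff_sigmaCompactSpace.1 (hσ i)
    exact EMetric.secondCountable_of_sigmaCompact _
  have hcol : ∀ i, HasZeroDimensionalColoring n (p ⁻¹' {i}) := fun i ↦ by
    obtain ⟨K, hK, hKU⟩ := hσ i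
    refine of_subset_iUnion_isClosed (fun m ↦ (hK m).isClosed) hKU.ge (fun m ↦ h _ (hK m))
      fun m ↦ ?_
    have := isCompact_iff_compactSpace.1 (hK m)
    infer_instance
  choose c hc using hcol
  refine ⟨fun x ↦ c (p x) ⟨x, rfl⟩, fun j ↦ ?_⟩
  refine .of_isLocallyConstant (hp.comp_continuous continuous_subtype_val) fun i ↦ ?_
  have hmem : ∀ y : ((p ∘ Subtype.val) ⁻¹' {i} :
      Set ((fun x ↦ c (p x) ⟨x, rfl⟩) ⁻¹' {j} : Set X)),
      c i ⟨y.1.1, y.2⟩ = j := by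
    rintro ⟨⟨x, hx⟩, hxi⟩
    obtain rfl : p x = i := hxi
    exact hx
  refine (hc i j).of_isEmbedding (f := fun y ↦ ⟨⟨y.1.1, y.2⟩, hmem y⟩) ?_
  exact IsEmbedding.of_comp (g := fun y ↦ y.1.1) (by fun_prop) (by fun_prop)
    (IsEmbedding.subtypeVal.comp IsEmbedding.subtypeVal)

/-! ### Strict bounds by natural numbers in `WithBot ℕ∞` -/

section Dimension

theorem sInf_setOf_forall_lt_natCast_iff {P : ℕ → Prop} (hP : Monotone P) {n : ℕ} :
    sInf {m : WithBot ℕ∞ | ∀ i : ℕ, m < i → P i} < n ↔ P n := by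
  constructor
  · intro h
    obtain ⟨m, hm, hmn⟩ := sInf_lt_iff.1 h
    exact hm n hmn
  · intro h
    cases n with
    | zero =>
      -- `P 0` gives every `P i`, so the infimum is `⊥`, which is dimension `-1`.
      refine lt_of_le_of_lt (sInf_le fun i _ ↦ hP (Nat.zero_le i) h) (b := ⊥) ?_
      exact WithBot.bot_lt_coe _
    | succ n =>
      refine lt_of_le_of_lt (sInf_le fun i hi ↦ hP ?_ h) (b := (n : WithBot ℕ∞)) ?_
      · exact_mod_cast hi
      · exact_mod_cast n.lt_succ_self

theorem WithBot.lt_natCast_succ_iff {a : WithBot ℕ∞} {n : ℕ} : a < (n + 1 : ℕ) ↔ a ≤ n := by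
  induction a using WithBot.recBotCoe with
  | bot => simp
  | coe a =>
    change (a : WithBot ℕ∞) < ((n + 1 : ℕ) : ℕ∞) ↔ (a : WithBot ℕ∞) ≤ (n : ℕ∞)
    rw [WithBot.coe_lt_coe, WithBot.coe_le_coe, Nat.cast_succ]
    exact ENat.lt_natCast_add_one_iff

theorem iSup_lt_natCast_iff {ι : Sort*} {f : ι → WithBot ℕ∞} {n : ℕ} :
    ⨆ i, f i < n ↔ ∀ i, f i < n := by
  refine ⟨fun h i ↦ (le_iSup f i).trans_lt h, fun h ↦ ?_⟩
  cases n with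
  | zero =>
    refine (iSup_le fun i ↦ ?_).trans_lt (WithBot.bot_lt_coe (0 : ℕ∞))
    have := h i
    rw [Nat.cast_zero, ← WithBot.coe_zero, WithBot.lt_coe_iff] at this
    refine le_of_eq (WithBot.eq_bot_iff_forall_ne.2 fun a ha ↦ ?_)
    exact not_lt_zero (this a ha.symm)
  | succ n =>
    exact WithBot.lt_natCast_succ_iff.2 (iSup_le fun i ↦ WithBot.lt_natCast_succ_iff.1 (h i))

theorem eq_of_forall_lt_natCast_iff {a b : WithBot ℕ∞} (h : ∀ n : ℕ, a < n ↔ b < n) : a = b := by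
  have key : ∀ {a b : WithBot ℕ∞}, (∀ n : ℕ, b < n → a < n) → a ≤ b := by
    intro a b h
    induction b using WithBot.recBotCoe with
    | bot =>
      have := h 0 (WithBot.bot_lt_coe _)
      refine le_of_eq (WithBot.eq_bot_iff_forall_ne.2 fun c hc ↦ ?_)
      subst hc
      exact not_lt_zero (WithBot.coe_lt_coe.1 this)
    | coe b =>
      induction b using ENat.recTopCoe with
      | top => exact le_top
      | coe b =>
        have := h (b + 1) (by norm_cast; exact b.lt_succ_self)
        induction a using WithBot.recBotCoe with
        | bot => exact bot_le
        | coe a =>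
          induction a using ENat.recTopCoe with
          | top => simp at this
          | coe a => norm_cast at this ⊢; exact Nat.lt_succ_iff.1 this
  exact le_antisymm (key fun n ↦ (h n).2) (key fun n ↦ (h n).1)

theorem HasLargeInductiveDimensionLT.succ {n : ℕ} : ∀ {X : Type u} [TopologicalSpace X],
    HasLargeInductiveDimensionLT n X → HasLargeInductiveDimensionLT (n + 1) X := by
  induction n with
  | zero =>
    intro X _ (h : IsEmpty X) A V hA hV hAV
    exact ⟨V, hV, hAV, Subset.rfl, ⟨fun x ↦ h.false x.1⟩⟩
  | succ n ih =>
    intro X _ h A V hA hV hAV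
    obtain ⟨U, hU, hAU, hUV, hf⟩ := h A V hA hV hAV
    exact ⟨U, hU, hAU, hUV, ih hf⟩

theorem largeInductiveDimension_lt_iff {X : Type u} [TopologicalSpace X] {n : ℕ} :
    largeInductiveDimension X < n ↔ HasLargeInductiveDimensionLT n X :=
  sInf_setOf_forall_lt_natCast_iff (P := fun n ↦ HasLargeInductiveDimensionLT n X)
    (monotone_nat_of_le_succ fun _ h ↦ h.succ)

theorem coveringDimension_lt_iff {X : Type u} [TopologicalSpace X] {n : ℕ} :
    coveringDimension X < n ↔ HasCoveringDimensionLT n X := by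
  refine sInf_setOf_forall_lt_natCast_iff (P := fun n ↦ HasCoveringDimensionLT n X) ?_
  intro m n hmn h 𝒰 hfin hopen hcov
  obtain ⟨𝒱, h₁, h₂, h₃, h₄, h₅⟩ := h 𝒰 hfin hopen hcov
  exact ⟨𝒱, h₁, h₂, h₃, h₄, fun x ↦ (h₅ x).trans (by exact_mod_cast hmn)⟩

variable {X : Type u} [TopologicalSpace X] {n : ℕ}

theorem indHat_lt_iff : indHat X < n ↔
    ∀ S : Set X, LocallyCompactSpace S → HasSmallInductiveDimensionLT S n := by
  simp only [indHat, iSup_lt_natCast_iff, smallInductiveDimension_lt_iff]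

theorem largeIndHat_lt_iff : largeIndHat X < n ↔
    ∀ S : Set X, LocallyCompactSpace S → HasLargeInductiveDimensionLT n S := by
  simp only [largeIndHat, iSup_lt_natCast_iff, largeInductiveDimension_lt_iff]

theorem dimHat_lt_iff : dimHat X < n ↔
    ∀ S : Set X, LocallyCompactSpace S → HasCoveringDimensionLT n S := by
  simp only [dimHat, iSup_lt_natCast_iff, coveringDimension_lt_iff]

end Dimension

/-! ### The hat dimensions and the separator argument -/

section Hats

variable {X : Type u} [MetricSpace X] {n : ℕ}

theorem HasZeroDimensionalColoring.of_locallyCompactSpace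
    (h : ∀ K : Set X, IsCompact K → HasZeroDimensionalColoring n K) (S : Set X)
    [LocallyCompactSpace S] : HasZeroDimensionalColoring n S := by
  refine of_forall_isCompact fun K hK ↦ ?_
  have hK' := hK.image continuous_subtype_val
  have := isCompact_iff_compactSpace.1 hK'
  exact (h _ hK').of_isEmbedding (IsEmbedding.subtypeVal.restrict (mapsTo_image Subtype.val K))

/-- The right-hand side is the same for all three hat dimensions, which is why they coincide. -/
theorem indHat_lt_iff_forall_isCompact : indHat X < n ↔
    ∀ K : Set X, IsCompact K → HasZeroDimensionalColoring n K := by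
  rw [indHat_lt_iff]
  refine ⟨fun h K hK ↦ ?_, fun h S _ ↦ ?_⟩
  · have := isCompact_iff_compactSpace.1 hK
    exact (h K inferInstance).hasZeroDimensionalColoring
  · exact (HasZeroDimensionalColoring.of_locallyCompactSpace h
      S).hasLargeInductiveDimensionLT.hasSmallInductiveDimensionLT

theorem largeIndHat_lt_iff_forall_isCompact : largeIndHat X < n ↔
    ∀ K : Set X, IsCompact K → HasZeroDimensionalColoring n K := by
  rw [largeIndHat_lt_iff]
  refine ⟨fun h K hK ↦ ?_, fun h S _ ↦ ?_⟩
  · have := isCompact_iff_compactSpace.1 hK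
    exact (h K inferInstance).hasSmallInductiveDimensionLT.hasZeroDimensionalColoring
  · exact (HasZeroDimensionalColoring.of_locallyCompactSpace h S).hasLargeInductiveDimensionLT

theorem dimHat_lt_iff_forall_isCompact : dimHat X < n ↔
    ∀ K : Set X, IsCompact K → HasZeroDimensionalColoring n K := by
  rw [dimHat_lt_iff]
  refine ⟨fun h K hK ↦ ?_, fun h S _ ↦ ?_⟩
  · have := isCompact_iff_compactSpace.1 hK
    exact (h K inferInstance).hasZeroDimensionalColoring
  · exact (HasZeroDimensionalColoring.of_locallyCompactSpace h S).hasCoveringDimensionLT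

/-- If in a compact metric space distinct points are separated by closed sets that split into `n`
zero-dimensional sets, then the whole space splits into `n + 1` such sets. -/
theorem HasZeroDimensionalColoring.of_isClosedSeparator {K : Type u} [MetricSpace K]
    [CompactSpace K] (h : ∀ x y : K, x ≠ y →
      ∃ L : Set K, IsClosedSeparator L x y ∧ HasZeroDimensionalColoring n L) :
    HasZeroDimensionalColoring (n + 1) K := by
  refine HasSmallInductiveDimensionLT.hasZeroDimensionalColoring (.succ n
    {U | IsOpen U ∧ HasSmallInductiveDimensionLT (frontier U) n}
    (isTopologicalBasis_of_isOpen_of_nhds (fun U hU ↦ hU.1) fun x V hx hV ↦ ?_) fun U hU ↦ hU.2)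
  have key : ∀ y : (Vᶜ : Set K), ∃ L A B : Set K, IsClosed L ∧ HasZeroDimensionalColoring n L ∧
      IsOpen A ∧ IsOpen B ∧ Disjoint A B ∧ A ∪ B = Lᶜ ∧ x ∈ A ∧ (y : K) ∈ B := by
    rintro ⟨y, hy⟩
    obtain ⟨L, ⟨hL, A, B, hA, hB, hAB, hU, hxA, hyB⟩, hc⟩ := h x y fun hxy ↦ hy (hxy ▸ hx)
    exact ⟨L, A, B, hL, hc, hA, hB, hAB, hU, hxA, hyB⟩
  choose L A B hL hc hA hB hAB hU hxA hyB using key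
  obtain ⟨t, ht⟩ := hV.isClosed_compl.isCompact.elim_finite_subcover B hB
    fun y hy ↦ mem_iUnion.2 ⟨⟨y, hy⟩, hyB ⟨y, hy⟩⟩
  -- A frontier point outside `A y` and off `L y` would lie in `B y`, an open set disjoint from `A
  -- y`, yet it is in the closure of `A y`.
  have hsub : frontier (⋂ y ∈ t, A y) ⊆ ⋃ y : t, L y := by
    intro z hz
    rw [(isOpen_biInter_finset fun y _ ↦ hA y).frontier_eq] at hz
    obtain ⟨hz, hzn⟩ := hz
    simp only [mem_iInter, not_forall] at hzn
    obtain ⟨y, hyt, hzy⟩ := hzn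
    refine mem_iUnion.2 ⟨⟨y, hyt⟩, ?_⟩
    by_contra hzL
    rcases (hU y ▸ hzL : z ∈ A y ∪ B y) with hzA | hzB
    · exact hzy hzA
    · exact Set.disjoint_left.1 ((hAB y).closure_left (hB y))
        (closure_mono (biInter_subset_of_mem hyt) hz) hzB
  refine ⟨⋂ y ∈ t, A y, ⟨isOpen_biInter_finset fun y _ ↦ hA y, ?_⟩, ?_, fun z hz ↦ ?_⟩
  · exact (of_subset_iUnion_isClosed (fun y : t ↦ hL y) hsub (fun y ↦ hc y)
      fun y ↦ inferInstance).hasLargeInductiveDimensionLT.hasSmallInductiveDimensionLT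
  · exact mem_iInter₂.2 fun y _ ↦ hxA y
  · by_contra hzV
    obtain ⟨y, hyt, hzB⟩ := mem_iUnion₂.1 (ht hzV)
    exact Set.disjoint_left.1 (hAB y) (mem_iInter₂.1 hz y hyt) hzB

theorem IsClosedSeparator.preimage {Y : Type u} [TopologicalSpace Y] {f : Y → X}
    (hf : Continuous f) {L : Set X} {x y : Y} (h : IsClosedSeparator L (f x) (f y)) :
    IsClosedSeparator (f ⁻¹' L) x y := by
  obtain ⟨hL, U, V, hU, hV, hd, hUV, hx, hy⟩ := h
  refine ⟨hL.preimage hf, f ⁻¹' U, f ⁻¹' V, hU.preimage hf, hV.preimage hf, hd.preimage f, ?_,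
    hx, hy⟩
  rw [← preimage_union, hUV, preimage_compl]

end Hats

/-- The condition `indHat L < D` says that the dimension of `L` is at most `D - 1`; for `D = 0`
this is `-1`, i.e. `L` is empty. -/
theorem mainTheorem8 {X : Type*} [MetricSpace X] (D : ℕ)
    (hsep : ∀ x y : X, x ≠ y → ∃ L : Set X, IsClosedSeparator L x y ∧ indHat L < D) :
    indHat X = largeIndHat X ∧ largeIndHat X = dimHat X ∧ dimHat X ≤ D := by
  refine ⟨eq_of_forall_lt_natCast_iff fun n ↦ ?_, eq_of_forall_lt_natCast_iff fun n ↦ ?_, ?_⟩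
  · rw [indHat_lt_iff_forall_isCompact, largeIndHat_lt_iff_forall_isCompact]
  · rw [largeIndHat_lt_iff_forall_isCompact, dimHat_lt_iff_forall_isCompact]
  have hlt : dimHat X < (D + 1 : ℕ) := by
    rw [dimHat_lt_iff_forall_isCompact]
    intro K hK
    have := isCompact_iff_compactSpace.1 hK
    refine .of_isClosedSeparator fun x y hxy ↦ ?_
    obtain ⟨L, hL, hdim⟩ := hsep x y (Subtype.coe_injective.ne hxy)
    refine ⟨Subtype.val ⁻¹' L, hL.preimage continuous_subtype_val, ?_⟩
    -- `L ∩ K` is viewed inside `L`, where the bound on `indHat L` gives a `D`-coloring, and then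
    -- transported into `K`.
    have hLK : IsCompact (Subtype.val ⁻¹' K : Set L) :=
      hL.1.isClosedEmbedding_subtypeVal.isCompact_preimage hK
    have := isCompact_iff_compactSpace.1 hLK
    refine (indHat_lt_iff_forall_isCompact.1 hdim _ hLK).of_isEmbedding
      (f := fun z ↦ ⟨⟨z.1.1, z.2⟩, z.1.2⟩) ?_
    exact IsEmbedding.of_comp (g := fun y ↦ y.1.1) (by fun_prop) (by fun_prop)
      (IsEmbedding.subtypeVal.comp IsEmbedding.subtypeVal)
  exact WithBot.lt_natCast_succ_iff.1 hlt
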